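/- Let $G$ be a locally compact Hausdorff abelian group, written additively, whose dual group $\hat G$ (continuous homomorphisms $G\to\mathbb T$ with the compact-open topology) is arcwise connected and locally arcwise connected. Let $\mathcal M_1(G)$ be the set of Radon (regular Borel) probability measures on $G$, and for $\mu\in\mathcal M_1(G)$ let $\hat\mu(\gamma)=\int_G\gamma\,d\mu$, $\gamma\in\hat G$. A function on $\hat G$ is called a characteristic function if it equals $\hat\nu$ for some $\nu\in\mathcal M_1(G)$. Call $\mu\in\mathcal M_1(G)$ admissible if $\hat\mu=e^{\psi}$ for some continuous $\psi:\hat G\to\mathbb C$ with $\psi(1)=0$; such a $\psi$ is unique and is called the second characteristic of $\mu$. For admissible $\mu$ with second characteristic $\psi$ put $$\Lambda(\mu)=\{t>0:\ e^{t\psi}\text{ is a characteristic function}\},$$ $$\Lambda^{\rm alg}(\mu)=\Big\{\tfrac mn:\ m,n\in\{1,2,\dots\}\text{ coprime, and }(\hat\mu)^m=f^n\text{ for some characteristic function }f\Big\}.$$ Let $\mu$ be admissible with second characteristic $\psi$. 1. Let $n\ge 1$ and let $\mu_{1/n}\in\mathcal M_1(G)$ satisfy $\mu=\mu_{1/n}*\cdots*\mu_{1/n}$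 ($n$ factors). Then $\mu_{1/n}$ is admissible, it is the only element of $\mathcal M_1(G)$ that solves this equation, and $\widehat{\mu_{1/n}}=e^{\psi/n}$. 2. For each $n\ge 1$, the equation in 1 has a solution $\mu_{1/n}\in\mathcal M_1(G)$ if and only if $1/n\in\Lambda(\mu)$. 3. $\Lambda^{\rm alg}(\mu)=\Lambda(\mu)\cap\mathbb Q$. -/

import Mathlib

open MeasureTheory

/-- The Pontryagin dual `Ĝ` of an additive locally compact abelian group `G`: continuous
homomorphisms from `G` to the unit circle, with pointwise multiplication and the topology of
uniform convergence on compact sets. (Mathlib's `PontryaginDual` takes multiplicative groups.) -/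
abbrev DualGroup (G : Type*) [AddCommGroup G] [TopologicalSpace G] : Type _ :=
  PontryaginDual (Multiplicative G)

/-- `M₁(G)`: the Radon (regular Borel) probability measures on `G`. Regularity is automatic when
`G` is second countable. -/
def RadonProb (G : Type*) [TopologicalSpace G] [MeasurableSpace G] : Set (Measure G) :=
  {μ | IsProbabilityMeasure μ ∧ μ.Regular}

/-- The Fourier transform `μ̂(γ) = ∫ γ(x) dμ(x)`. -/
noncomputable def fourierTransform {G : Type*} [AddCommGroup G] [TopologicalSpace G]
    [MeasurableSpace G] (μ : Measure G) (γ : DualGroup G) : ℂ :=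
  ∫ x, (γ (Multiplicative.ofAdd x) : ℂ) ∂μ

/-- A characteristic function on `Ĝ` is the Fourier transform of some element of `M₁(G)`. -/
def IsCharacteristicFunction {G : Type*} [AddCommGroup G] [TopologicalSpace G]
    [MeasurableSpace G] (f : DualGroup G → ℂ) : Prop :=
  ∃ ν ∈ RadonProb G, ∀ γ, fourierTransform ν γ = f γ

/-- `ψ` is a second characteristic of `μ`: it is continuous, `ψ(1) = 0` and `μ̂ = e^ψ`. -/
def IsSecondCharacteristic {G : Type*} [AddCommGroup G] [TopologicalSpace G]
    [MeasurableSpace G] (μ : Measure G) (ψ : DualGroup G → ℂ) : Prop :=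
  Continuous ψ ∧ ψ 1 = 0 ∧ ∀ γ, fourierTransform μ γ = Complex.exp (ψ γ)

/-- `M₁ᵃ(G)`: the admissible probability measures on `G`. -/
def AdmissibleProb (G : Type*) [AddCommGroup G] [TopologicalSpace G] [MeasurableSpace G] :
    Set (Measure G) :=
  {μ | μ ∈ RadonProb G ∧ ∃ ψ : DualGroup G → ℂ, IsSecondCharacteristic μ ψ}

/-- The second characteristic is unique if `Ĝ` is connected. -/
theorem IsSecondCharacteristic.unique {G : Type*} [AddCommGroup G] [TopologicalSpace G]
    [MeasurableSpace G] [PreconnectedSpace (DualGroup G)] {μ : Measure G}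
    {ψ₁ ψ₂ : DualGroup G → ℂ} (h₁ : IsSecondCharacteristic μ ψ₁)
    (h₂ : IsSecondCharacteristic μ ψ₂) : ψ₁ = ψ₂ := by
  obtain ⟨c₁, z₁, e₁⟩ := h₁
  obtain ⟨c₂, z₂, e₂⟩ := h₂
  have key : ∀ γ, ∃ k : ℤ, ψ₁ γ = ψ₂ γ + k * (2 * Real.pi * Complex.I) := fun γ =>
    Complex.exp_eq_exp_iff_exists_int.1 ((e₁ γ).symm.trans (e₂ γ))
  choose k hk using key
  have hpi : (2 * Real.pi : ℝ) ≠ 0 := by positivity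
  have hk' : ∀ γ, ((k γ : ℤ) : ℝ) = (ψ₁ γ - ψ₂ γ).im / (2 * Real.pi) := by
    intro γ
    rw [hk γ, eq_div_iff hpi]
    simp
  have hcR : Continuous fun γ => ((k γ : ℤ) : ℝ) := by
    simp_rw [hk']
    fun_prop
  have hc : Continuous k := Int.isClosedEmbedding_coe_real.isInducing.continuous_iff.2 hcR
  have h1 : k 1 = 0 := by
    have : ((k 1 : ℤ) : ℝ) = 0 := by rw [hk', z₁, z₂]; simp
    exact_mod_cast this
  funext γ
  have h2 : k γ = k 1 := PreconnectedSpace.constant inferInstance hc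
  rw [hk γ, h2, h1]
  simp

/-- `Λ(μ) = {t > 0 : e^{tψ} is a characteristic function}`, where `ψ` is the second
characteristic of `μ` (unique when the dual group is connected). -/
def Lam {G : Type*} [AddCommGroup G] [TopologicalSpace G] [MeasurableSpace G]
    (μ : Measure G) : Set ℝ :=
  {t | 0 < t ∧ ∃ ψ : DualGroup G → ℂ, IsSecondCharacteristic μ ψ ∧
    IsCharacteristicFunction fun γ : DualGroup G => Complex.exp ((t : ℂ) * ψ γ)}

/-- `Λ^alg(μ)`: the positive rationals `m / n` in lowest terms for which `(μ̂)^m = f^n` for some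
characteristic function `f`. -/
def LamAlg {G : Type*} [AddCommGroup G] [TopologicalSpace G] [MeasurableSpace G]
    (μ : Measure G) : Set ℝ :=
  {q | ∃ m n : ℕ, 0 < m ∧ 0 < n ∧ m.Coprime n ∧ q = (m : ℝ) / n ∧
    ∃ f : DualGroup G → ℂ, IsCharacteristicFunction f ∧
      ∀ γ, fourierTransform μ γ ^ m = f γ ^ n}

/-- Convolution of measures, `(μ ∗ ν)(B) = ∫ ν(B - x) dμ(x)`. For Radon probability measures
`x ↦ ν(B - x)` is Borel for every Borel set `B`, also when `G` is not second countable and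
addition need not be measurable for the product of the Borel σ-algebras. -/
noncomputable def measConv {G : Type*} [AddCommGroup G] [MeasurableSpace G]
    (μ ν : Measure G) : Measure G :=
  μ.bind fun x => ν.map fun y => x + y

/-- The convolution above is Mathlib's one whenever addition is jointly measurable. -/
theorem measConv_eq_conv {G : Type*} [AddCommGroup G] [MeasurableSpace G]
    [MeasurableAdd₂ G] (μ ν : Measure G) [SFinite ν] :
    measConv μ ν = μ.conv ν := by
  ext s hs
  have hadd : Measurable fun p : G × G => p.1 + p.2 := measurable_add
  have hpre : MeasurableSet ((fun p : G × G => p.1 + p.2) ⁻¹' s) := hadd hs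
  have hmap : ∀ (x : G) (t : Set G), MeasurableSet t →
      (ν.map fun y => x + y) t = ν (Prod.mk x ⁻¹' ((fun p : G × G => p.1 + p.2) ⁻¹' t)) :=
    fun x t ht => Measure.map_apply (measurable_const_add x) ht
  have hm : Measurable fun x : G => ν.map fun y => x + y := by
    refine Measure.measurable_of_measurable_coe _ fun t ht => ?_
    simp_rw [fun x => hmap x t ht]
    exact measurable_measure_prodMk_left (hadd ht)
  rw [measConv, Measure.bind_apply hs hm.aemeasurable, Measure.conv,
    Measure.map_apply hadd hs, Measure.prod_apply hpre]
  simp_rw [fun x => hmap x s hs]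

/-- The `n`-fold convolution `ν ∗ ⋯ ∗ ν`, with the point mass at `0` for `n = 0`. -/
noncomputable def convPower {G : Type*} [AddCommGroup G] [MeasurableSpace G]
    (ν : Measure G) : ℕ → Measure G
  | 0 => Measure.dirac 0
  | n + 1 => measConv (convPower ν n) ν

/-! The Fourier transform turns n-fold convolution into n-th powers, so two facts suffice. First, on
the connected space Ĝ a continuous f with f(1) = 1 and fⁿ = e^ψ, ψ(1) = 0, must be e^{ψ/n}
(`eq_exp_of_pow_eq_exp`). Second, a Radon probability measure is determined by its Fourier transform
(`eq_of_fourierTransform_eq`).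

For the second fact, let π be translation on L²(G) and T = ∫ f(y) π(y) dy with f a bump near 0. Then
x ↦ π(x)T is norm continuous, with values in the bicommutant of π, a commutative C⋆-algebra. For a
Gelfand character χ of that algebra with χ(T) ≠ 0, x ↦ χ(π(x)) is a continuous character γ of G, and
χ(∫ π(x)T dμ) = μ̂(γ) χ(T). Hence ∫ π(x)T dμ depends only on μ̂. Letting the bumps shrink, the same
holds for integrals of matrix coefficients ⟨ψ, π(x)φ⟩, and these approximate every k ∈ C_c(G)
uniformly.

Convolution must also preserve Radon probability measures and be multiplicative under the transform.
Lower semicontinuity of x ↦ ν(U - x) for open U supplies the measurability and regularity. -/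

/-! ### Integrating continuous functions against regular measures. -/

section Tightness

variable {X E : Type*} [TopologicalSpace X] [T2Space X] [MeasurableSpace X] [BorelSpace X]
  [NormedAddCommGroup E]

/-- A regular finite measure is concentrated, up to small mass, on a compact set. -/
theorem exists_isCompact_measure_compl_lt (μ : Measure X) [IsFiniteMeasure μ] [μ.Regular]
    {ε : ENNReal} (hε : ε ≠ 0) : ∃ K, IsCompact K ∧ μ Kᶜ < ε := by
  obtain ⟨K, -, hK, h⟩ := MeasurableSet.univ.exists_isCompact_sdiff_lt (μ := μ)
    (measure_ne_top μ _) hε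
  exact ⟨K, hK, by rwa [Set.compl_eq_univ_sdiff]⟩

/-- Continuous functions are strongly measurable for regular finite measures, without any
countability assumption. -/
theorem Continuous.aestronglyMeasurable_of_regular {F : X → E} (hF : Continuous F)
    (μ : Measure X) [IsFiniteMeasure μ] [μ.Regular] : AEStronglyMeasurable F μ := by
  have h : ∀ n : ℕ, ∃ K, IsCompact K ∧ μ Kᶜ < ((n : ENNReal) + 1)⁻¹ := fun n =>
    exists_isCompact_measure_compl_lt μ (ENNReal.inv_ne_zero.2 (by finiteness))
  choose K hK hμK using h
  have hnull : μ (⋃ n, K n)ᶜ = 0 := by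
    refine le_antisymm (le_of_forall_pos_le_add fun ε hε => ?_) zero_le
    obtain ⟨n, hn⟩ := ENNReal.exists_inv_nat_lt hε.ne'
    rw [zero_add]
    calc μ (⋃ n, K n)ᶜ ≤ μ (K n)ᶜ :=
          measure_mono (Set.compl_subset_compl.2 (Set.subset_iUnion K n))
      _ ≤ ((n : ENNReal) + 1)⁻¹ := (hμK n).le
      _ ≤ (n : ENNReal)⁻¹ := ENNReal.inv_le_inv.2 le_self_add
      _ ≤ ε := hn.le
  -- The measure lives on a σ-compact set, and on each compact piece the range of `F` is compact,
  -- hence separable.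
  have : μ.restrict (⋃ n, K n) = μ := Measure.restrict_eq_self_of_ae_mem hnull
  rw [← this]
  exact aestronglyMeasurable_iUnion_iff.2 fun n =>
    hF.continuousOn.aestronglyMeasurable_of_isCompact (hK n) (hK n).measurableSet

theorem Continuous.integrable_of_regular {F : X → E} (hF : Continuous F) {C : ℝ}
    (hC : ∀ x, ‖F x‖ ≤ C) (μ : Measure X) [IsFiniteMeasure μ] [μ.Regular] : Integrable F μ :=
  .of_bound (hF.aestronglyMeasurable_of_regular μ) C (.of_forall hC)

end Tightness

/-! ### Commutative bicommutants and Gelfand theory. -/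

section Bicommutant

variable {B : Type*} [CStarAlgebra B]

/-- The bicommutant of a set of operators, as a star subalgebra. -/
noncomputable abbrev starBicommutant (S : Set B) : StarSubalgebra ℂ B :=
  StarSubalgebra.centralizer ℂ (StarSubalgebra.centralizer ℂ S : Set B)

theorem isClosed_starBicommutant (S : Set B) : IsClosed (starBicommutant S : Set B) := by
  rw [StarSubalgebra.coe_centralizer]
  exact Set.isClosed_centralizer _

instance (S : Set B) : CompleteSpace (starBicommutant S) :=
  (isClosed_starBicommutant S).completeSpace_coe

theorem subset_starBicommutant (S : Set B) : S ⊆ starBicommutant S :=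
  (StarAlgebra.subset_adjoin ℂ S).trans (StarAlgebra.adjoin_le_centralizer_centralizer ℂ S)

/-- The bicommutant of a commuting self-adjoint set is commutative. -/
@[reducible]
noncomputable def normedCommRingStarBicommutant (S : Set B)
    (hS : ∀ a ∈ S ∪ star S, ∀ b ∈ S ∪ star S, a * b = b * a) :
    NormedCommRing (starBicommutant S) :=
  { SubringClass.toNormedRing (starBicommutant S) with
    mul_comm := fun a b => by
      have ha := a.2
      have hb := b.2
      rw [← SetLike.mem_coe, StarSubalgebra.coe_centralizer_centralizer] at ha hb
      exact Subtype.ext (Set.centralizer_centralizer_comm_of_comm hS _ ha _ hb) }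

/-- The bicommutant of a commuting self-adjoint set is a commutative C⋆-algebra. -/
@[reducible]
noncomputable def commCStarAlgebraStarBicommutant (S : Set B)
    (hS : ∀ a ∈ S ∪ star S, ∀ b ∈ S ∪ star S, a * b = b * a) :
    CommCStarAlgebra (starBicommutant S) :=
  letI := normedCommRingStarBicommutant S hS
  { }

/-- Characters separate the points of the bicommutant of a commuting self-adjoint set. -/
theorem starBicommutant_eq_zero_of_forall_character (S : Set B)
    (hS : ∀ a ∈ S ∪ star S, ∀ b ∈ S ∪ star S, a * b = b * a) (a : starBicommutant S)
    (h : ∀ χ : starBicommutant S →L[ℂ] ℂ, (∀ b c, χ (b * c) = χ b * χ c) → χ 1 = 1 →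
      (∀ b, ‖χ b‖ ≤ ‖b‖) → χ a = 0) : a = 0 := by
  by_contra ha
  let : CommCStarAlgebra (starBicommutant S) := commCStarAlgebraStarBicommutant S hS
  have : Nontrivial (starBicommutant S) := ⟨a, 0, ha⟩
  refine ha ((gelfandTransform_isometry (starBicommutant S)).injective ?_)
  ext χ
  rw [map_zero]
  exact h (WeakDual.CharacterSpace.toCLM χ) (fun b c => map_mul χ b c) (map_one χ)
    (fun b => (spectrum.norm_le_norm_of_mem (AlgHom.apply_mem_spectrum χ b)))

end Bicommutant

/-! ### From Gelfand characters to characters of the group. -/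

section UnitaryRepresentation

variable {G : Type*} [AddCommGroup G] [TopologicalSpace G]
  {H : Type*} [NormedAddCommGroup H] [InnerProductSpace ℂ H] [CompleteSpace H]

/-- A norm-continuous unimodular function that is additive-to-multiplicative is a character. -/
theorem exists_dualGroup_eq (c : G → ℂ) (hc : Continuous c) (h0 : c 0 = 1)
    (hadd : ∀ x y, c (x + y) = c x * c y) (hle : ∀ x, ‖c x‖ ≤ 1) :
    ∃ γ : DualGroup G, ∀ x, (γ (Multiplicative.ofAdd x) : ℂ) = c x := by
  have hn : ∀ x, ‖c x‖ = 1 := fun x => by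
    have h : ‖c x‖ * ‖c (-x)‖ = 1 := by rw [← norm_mul, ← hadd, add_neg_cancel, h0, norm_one]
    nlinarith [hle x, hle (-x), norm_nonneg (c x), norm_nonneg (c (-x))]
  let f : Multiplicative G →ₜ* Circle :=
    { toFun := fun x => ⟨c x.toAdd, mem_sphere_zero_iff_norm.2 (hn _)⟩
      map_one' := Subtype.ext h0
      map_mul' := fun x y => Subtype.ext (hadd _ _)
      continuous_toFun := (hc.comp continuous_toAdd).subtype_mk _ }
  exact ⟨f, fun x => rfl⟩

/-- A strongly continuous unitary representation of an abelian group on a Hilbert space. -/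
structure UnitaryRep (G H : Type*) [AddCommGroup G] [TopologicalSpace G] [NormedAddCommGroup H]
    [InnerProductSpace ℂ H] [CompleteSpace H] where
  /-- The operators of the representation. -/
  op : G → H →L[ℂ] H
  op_zero : op 0 = 1
  op_add : ∀ x y, op (x + y) = op x * op y
  star_op : ∀ x, star (op x) = op (-x)
  norm_op_le : ∀ x, ‖op x‖ ≤ 1
  continuous_op : ∀ φ, Continuous fun x => op x φ

/-- The operators `∫ π(x) T dμ(x)` attached to a unitary representation `π` depend only on the
Fourier transform of `μ`, provided that `x ↦ π(x) T` is norm continuous and that `T` lies in the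
von Neumann algebra generated by `π`. -/
theorem UnitaryRep.integral_mul_eq_of_fourierTransform_eq [T2Space G] [MeasurableSpace G]
    [BorelSpace G] (ρ : UnitaryRep G H) (T : H →L[ℂ] H)
    (hT : T ∈ starBicommutant (Set.range ρ.op)) (hTc : Continuous fun x => ρ.op x * T)
    (μ ν : Measure G) [IsProbabilityMeasure μ]
    [IsProbabilityMeasure ν] [μ.Regular] [ν.Regular]
    (h : ∀ γ : DualGroup G, fourierTransform μ γ = fourierTransform ν γ) :
    ∫ x, ρ.op x * T ∂μ = ∫ x, ρ.op x * T ∂ν := by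
  let π := ρ.op
  have hadd : ∀ x y, π (x + y) = π x * π y := ρ.op_add
  have hle : ∀ x, ‖π x‖ ≤ 1 := ρ.norm_op_le
  let S := Set.range π
  have hSstar : S ∪ star S = S := by
    refine Set.union_eq_left.2 ?_
    rintro a ⟨x, hx⟩
    exact ⟨-x, (ρ.star_op x).symm.trans ((congrArg star hx).trans (star_star a))⟩
  have hS : ∀ a ∈ S ∪ star S, ∀ b ∈ S ∪ star S, a * b = b * a := by
    rw [hSstar]
    rintro _ ⟨x, rfl⟩ _ ⟨y, rfl⟩
    rw [← hadd, ← hadd, add_comm]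
  let P : G → starBicommutant S := fun x => ⟨π x, subset_starBicommutant S ⟨x, rfl⟩⟩
  let t : starBicommutant S := ⟨T, hT⟩
  have hP0 : P 0 = 1 := Subtype.ext ρ.op_zero
  have hPadd : ∀ x y, P (x + y) = P x * P y := fun x y => Subtype.ext (hadd x y)
  have hPle : ∀ x, ‖P x‖ ≤ 1 := hle
  have hFc : Continuous fun x => P x * t := hTc.subtype_mk _
  have hFle : ∀ x, ‖P x * t‖ ≤ ‖t‖ := fun x =>
    (norm_mul_le _ _).trans (mul_le_of_le_one_left (norm_nonneg _) (hPle x))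
  have hFμ := hFc.integrable_of_regular hFle μ
  have hFν := hFc.integrable_of_regular hFle ν
  have key : ∫ x, P x * t ∂μ - ∫ x, P x * t ∂ν = 0 := by
    refine starBicommutant_eq_zero_of_forall_character S hS _ fun χ hmul hone hχ => ?_
    rw [map_sub, ← χ.integral_comp_comm hFμ, ← χ.integral_comp_comm hFν]
    simp_rw [hmul]
    -- If χ(T) = 0, both integrals vanish under χ. Otherwise dividing by χ(T) turns norm continuity
    -- of π(x)T into continuity of x ↦ χ(π(x)).
    by_cases ht : χ t = 0
    · simp [ht]
    obtain ⟨γ, hγ⟩ := exists_dualGroup_eq (fun x => χ (P x))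
      ((((χ.continuous.comp hFc).div_const (χ t))).congr fun x => by
        simp [hmul, ht]) (by simp [hP0, hone])
      (fun x y => by simp [hPadd, hmul]) (fun x => (hχ _).trans (hPle x))
    have := h γ
    simp only [fourierTransform, hγ] at this
    rw [integral_mul_const, integral_mul_const, this, sub_self]
  let ι : starBicommutant S →L[ℂ] H →L[ℂ] H :=
    { toFun := Subtype.val
      map_add' := fun _ _ => rfl
      map_smul' := fun _ _ => rfl
      cont := continuous_subtype_val }
  have h2 := congrArg ι key
  rw [map_sub, map_zero, sub_eq_zero, ← ι.integral_comp_comm hFμ, ← ι.integral_comp_comm hFν] at h2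
  exact h2

end UnitaryRepresentation

/-! ### Approximate identities. -/

section Bump

open Measure in
/-- Continuous bump functions of mass one with support in a given neighbourhood of `0`. -/
theorem exists_bump_of_mem_nhds_zero {G : Type*} [AddCommGroup G] [TopologicalSpace G]
    [IsTopologicalAddGroup G] [LocallyCompactSpace G] [MeasurableSpace G] [BorelSpace G]
    {V : Set G} (hV : V ∈ nhds (0 : G)) :
    ∃ f : G → ℝ, Continuous f ∧ HasCompactSupport f ∧ (∀ x, 0 ≤ f x) ∧ (∀ x ∉ V, f x = 0) ∧
      ∫ x, f x ∂(addHaar : Measure G) = 1 := by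
  obtain ⟨U, hUV, hU, h0⟩ := mem_nhds_iff.1 hV
  obtain ⟨f, h1, hf0, hfc, hf⟩ := exists_continuous_one_zero_of_isCompact
    (isCompact_singleton (x := (0 : G))) hU.isClosed_compl
    (Set.disjoint_compl_right_iff_subset.2 (Set.singleton_subset_iff.2 h0))
  have hpos : 0 < ∫ x, f x ∂(addHaar : Measure G) :=
    f.continuous.integral_pos_of_hasCompactSupport_nonneg_nonzero hfc (fun x => (hf x).1)
      (x := 0) (by rw [h1 rfl]; simp)
  refine ⟨fun x => (∫ x, f x ∂(addHaar : Measure G))⁻¹ * f x, by fun_prop, hfc.mul_left,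
    fun x => mul_nonneg (inv_nonneg.2 hpos.le) (hf x).1, fun x hx => ?_, ?_⟩
  · have : f x = 0 := hf0 fun h => hx (hUV h)
    simp [this]
  · rw [integral_const_mul, inv_mul_cancel₀ hpos.ne']

/-- Averaging against a probability density concentrated where `F` is close to `e`. -/
theorem norm_integral_smul_sub_le {G : Type*} [TopologicalSpace G] [MeasurableSpace G]
    [BorelSpace G] {E : Type*} [NormedAddCommGroup E] [NormedSpace ℝ E]
    [CompleteSpace E] {f : G → ℝ} (hfc : Continuous f) (hfs : HasCompactSupport f)
    (hf0 : ∀ x, 0 ≤ f x) (m : Measure G) [IsFiniteMeasureOnCompacts m]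
    (hf1 : ∫ x, f x ∂m = 1) {V : Set G} (hfV : ∀ x ∉ V, f x = 0) {F : G → E}
    (hF : Continuous F) {e : E} {ε : ℝ} (h : ∀ x ∈ V, ‖F x - e‖ ≤ ε) :
    ‖∫ x, f x • F x ∂m - e‖ ≤ ε := by
  have hi : Integrable f m := hfc.integrable_of_hasCompactSupport hfs
  have hiF : Integrable (fun x => f x • F x) m :=
    (hfc.smul hF).integrable_of_hasCompactSupport hfs.smul_right
  have : ∫ x, f x • F x ∂m - e = ∫ x, f x • (F x - e) ∂m := by
    simp_rw [smul_sub]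
    rw [integral_sub hiF (hi.smul_const e), integral_smul_const, hf1, one_smul]
  rw [this]
  calc ‖∫ x, f x • (F x - e) ∂m‖ ≤ ∫ x, f x * ε ∂m := by
        refine norm_integral_le_of_norm_le (hi.mul_const ε) (.of_forall fun x => ?_)
        rw [norm_smul, Real.norm_of_nonneg (hf0 x)]
        by_cases hx : x ∈ V
        · exact mul_le_mul_of_nonneg_left (h x hx) (hf0 x)
        · simp [hfV x hx]
    _ = ε := by rw [integral_mul_const, hf1, one_mul]

end Bump

/-! ### Smoothing a representation by averaging. -/

section Averaging

variable {G : Type*} [AddCommGroup G] [TopologicalSpace G]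
  {H : Type*} [NormedAddCommGroup H] [InnerProductSpace ℂ H] [CompleteSpace H]

namespace UnitaryRep

variable (ρ : UnitaryRep G H)

theorem norm_op_apply_le (x : G) (φ : H) : ‖ρ.op x φ‖ ≤ ‖φ‖ :=
  ((ρ.op x).le_of_opNorm_le (ρ.norm_op_le x) φ).trans_eq (one_mul _)

theorem integrable_smul_op [MeasurableSpace G] [BorelSpace G] {f : G → ℝ}
    (hfc : Continuous f) (hfs : HasCompactSupport f)
    (m : Measure G) [IsFiniteMeasureOnCompacts m] (φ : H) :
    Integrable (fun y => f y • ρ.op y φ) m :=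
  (hfc.smul (ρ.continuous_op φ)).integrable_of_hasCompactSupport hfs.smul_right

variable [IsTopologicalAddGroup G] [LocallyCompactSpace G] [MeasurableSpace G] [BorelSpace G]

/-- The operator `∫ f(y) π(y) dy` for `f` continuous with compact support. -/
noncomputable def average {f : G → ℝ} (hfc : Continuous f) (hfs : HasCompactSupport f) :
    H →L[ℂ] H :=
  LinearMap.mkContinuous
    { toFun := fun φ => ∫ y, f y • ρ.op y φ ∂(Measure.addHaar : Measure G)
      map_add' := fun φ ψ => by
        simp_rw [map_add, smul_add]
        exact integral_add (ρ.integrable_smul_op hfc hfs _ φ) (ρ.integrable_smul_op hfc hfs _ ψ)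
      map_smul' := fun c φ => by
        simp_rw [map_smul, smul_comm _ c]
        exact integral_smul c _ }
    (∫ y, ‖f y‖ ∂(Measure.addHaar : Measure G)) fun φ => by
      rw [← integral_mul_const]
      refine norm_integral_le_of_norm_le
        ((hfc.integrable_of_hasCompactSupport hfs).norm.mul_const _) (.of_forall fun y => ?_)
      rw [norm_smul]
      exact mul_le_mul_of_nonneg_left (ρ.norm_op_apply_le y φ) (norm_nonneg _)

theorem average_apply {f : G → ℝ} (hfc : Continuous f) (hfs : HasCompactSupport f) (φ : H) :
    ρ.average hfc hfs φ = ∫ y, f y • ρ.op y φ ∂(Measure.addHaar : Measure G) :=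
  rfl

/-- A bounded operator commuting with every π(y) passes through the integral. Since that integral is
formed vector by vector, the bicommutant is used rather than the norm-closed algebra generated by π.
-/
theorem average_mem_starBicommutant {f : G → ℝ} (hfc : Continuous f)
    (hfs : HasCompactSupport f) :
    ρ.average hfc hfs ∈ starBicommutant (Set.range ρ.op) := by
  have key : ∀ g ∈ StarSubalgebra.centralizer ℂ (Set.range ρ.op),
      g * ρ.average hfc hfs = ρ.average hfc hfs * g := by
    intro g hg
    ext φ
    rw [mul_apply_eq_comp, mul_apply_eq_comp, average_apply,
      average_apply, ← g.integral_comp_comm (ρ.integrable_smul_op hfc hfs _ φ)]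
    refine integral_congr_ae (.of_forall fun y => ?_)
    have h := ((StarSubalgebra.mem_centralizer_iff ℂ).1 hg _ ⟨y, rfl⟩).1
    have h2 : ρ.op y (g φ) = g (ρ.op y φ) := DFunLike.congr_fun h φ
    simp only [h2]
    exact g.map_smul_of_tower (f y) (ρ.op y φ)
  exact (StarSubalgebra.mem_centralizer_iff ℂ).2 fun g hg => ⟨key g hg, key _ (star_mem hg)⟩

theorem op_average_apply {f : G → ℝ} (hfc : Continuous f) (hfs : HasCompactSupport f) (x : G)
    (φ : H) : ρ.op x (ρ.average hfc hfs φ) =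
      ∫ y, f (-x + y) • ρ.op y φ ∂(Measure.addHaar : Measure G) := by
  rw [average_apply, ← (ρ.op x).integral_comp_comm (ρ.integrable_smul_op hfc hfs _ φ),
    ← integral_add_left_eq_self (fun y => f (-x + y) • ρ.op y φ) x]
  refine integral_congr_ae (.of_forall fun y => ?_)
  simp only [neg_add_cancel_left, op_add]
  exact (ρ.op x).map_smul_of_tower (f y) (ρ.op y φ)

/-- By invariance of Haar measure, π(x)T is the average for the translate f(-x + ·). Thus ‖π(x)T -
π(z)T‖ is at most the L¹ distance of two translates of f, and translation is continuous in L¹. -/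
theorem continuous_op_mul_average [T2Space G] {f : G → ℝ} (hfc : Continuous f)
    (hfs : HasCompactSupport f) :
    Continuous fun x => ρ.op x * ρ.average hfc hfs := by
  have hf1 : MemLp f 1 (Measure.addHaar : Measure G) := hfc.memLp_of_hasCompactSupport hfs
  let g : C(G, C(G, G)) := (ContinuousMap.mk (fun a : G × G => -a.1 + a.2) (by fun_prop)).curry
  have hg : ∀ x, MeasurePreserving (g x) (Measure.addHaar : Measure G) Measure.addHaar :=
    fun x => measurePreserving_add_left _ (-x)
  let F : G → Lp ℝ 1 (Measure.addHaar : Measure G) := fun x =>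
    Lp.compMeasurePreserving (g x) (hg x) (hf1.toLp f)
  have hF : Continuous F :=
    continuous_const.compMeasurePreservingLp g.continuous hg ENNReal.one_ne_top
  have hdist : ∀ x z, ‖F x - F z‖ =
      ∫ y, ‖f (-x + y) - f (-z + y)‖ ∂(Measure.addHaar : Measure G) := by
    intro x z
    rw [L1.norm_eq_integral_norm]
    refine integral_congr_ae ?_
    simp only [F, Lp.toLp_compMeasurePreserving hf1]
    filter_upwards [Lp.coeFn_sub ((hf1.comp_measurePreserving (hg x)).toLp _)
      ((hf1.comp_measurePreserving (hg z)).toLp _),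
      (hf1.comp_measurePreserving (hg x)).coeFn_toLp,
      (hf1.comp_measurePreserving (hg z)).coeFn_toLp] with y h1 h2 h3
    rw [h1, Pi.sub_apply, h2, h3]
    rfl
  have hi : ∀ x, Integrable (fun y => f (-x + y)) (Measure.addHaar : Measure G) := fun x =>
    ((hfc.integrable_of_hasCompactSupport hfs).comp_add_left (-x))
  have hcs : ∀ x, HasCompactSupport (fun y => f (-x + y)) := fun x =>
    hfs.comp_homeomorph (Homeomorph.addLeft (-x))
  refine continuous_iff_continuousAt.2 fun z => tendsto_iff_norm_sub_tendsto_zero.2 ?_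
  refine squeeze_zero (fun _ => norm_nonneg _) (fun x => ?_)
    (tendsto_iff_norm_sub_tendsto_zero.1 (hF.tendsto z))
  refine ContinuousLinearMap.opNorm_le_bound _ (norm_nonneg _) fun φ => ?_
  rw [hdist, sub_apply, mul_apply_eq_comp,
    mul_apply_eq_comp, op_average_apply, op_average_apply,
    ← integral_sub (ρ.integrable_smul_op (by fun_prop) (hcs x) _ φ)
      (ρ.integrable_smul_op (by fun_prop) (hcs z) _ φ), ← integral_mul_const]
  refine norm_integral_le_of_norm_le (((hi x).sub (hi z)).norm.mul_const _)
    (.of_forall fun y => ?_)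
  rw [← sub_smul, norm_smul]
  exact mul_le_mul_of_nonneg_left (ρ.norm_op_apply_le y φ) (norm_nonneg _)

end UnitaryRep

end Averaging

/-! ### The regular representation. -/

section RegularRepresentation

variable {G : Type*} [AddCommGroup G] [TopologicalSpace G] [IsTopologicalAddGroup G]
  [LocallyCompactSpace G] [MeasurableSpace G] [BorelSpace G]

/-- Translation on `L²(G)`. -/
noncomputable def translateL2 (x : G) :
    Lp ℂ 2 (Measure.addHaar : Measure G) →ₗᵢ[ℂ] Lp ℂ 2 (Measure.addHaar : Measure G) :=
  Lp.compMeasurePreservingₗᵢ ℂ (x + ·) (measurePreserving_add_left Measure.addHaar x)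

theorem translateL2_toLp (x : G) {f : G → ℂ} (hf : MemLp f 2 (Measure.addHaar : Measure G)) :
    translateL2 x (hf.toLp f) =
      (hf.comp_measurePreserving (measurePreserving_add_left Measure.addHaar x)).toLp
        (fun y => f (x + y)) :=
  rfl

theorem translateL2_zero (φ : Lp ℂ 2 (Measure.addHaar : Measure G)) : translateL2 0 φ = φ := by
  obtain ⟨f, hf, rfl⟩ : ∃ f, ∃ hf : MemLp f 2 (Measure.addHaar : Measure G), hf.toLp f = φ :=
    ⟨φ, Lp.memLp φ, Lp.toLp_coeFn φ _⟩
  simp [translateL2_toLp]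

theorem translateL2_add (x y : G) (φ : Lp ℂ 2 (Measure.addHaar : Measure G)) :
    translateL2 (x + y) φ = translateL2 x (translateL2 y φ) := by
  obtain ⟨f, hf, rfl⟩ : ∃ f, ∃ hf : MemLp f 2 (Measure.addHaar : Measure G), hf.toLp f = φ :=
    ⟨φ, Lp.memLp φ, Lp.toLp_coeFn φ _⟩
  simp only [translateL2_toLp]
  congr 1
  ext z
  rw [add_assoc, add_left_comm]

/-- The regular representation of `G` on `L²(G)`. -/
noncomputable def regularRep (G : Type*) [AddCommGroup G] [TopologicalSpace G]
    [IsTopologicalAddGroup G] [LocallyCompactSpace G] [T2Space G] [MeasurableSpace G]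
    [BorelSpace G] : UnitaryRep G (Lp ℂ 2 (Measure.addHaar : Measure G)) where
  op x := (translateL2 x).toContinuousLinearMap
  op_zero := by ext1 φ; exact translateL2_zero φ
  op_add x y := by ext1 φ; exact translateL2_add x y φ
  star_op x := by
    rw [ContinuousLinearMap.star_eq_adjoint, eq_comm, ContinuousLinearMap.eq_adjoint_iff]
    intro φ ψ
    change inner ℂ (translateL2 (-x) φ) ψ = inner ℂ φ (translateL2 x ψ)
    rw [← (translateL2 x).inner_map_map, ← translateL2_add, add_neg_cancel, translateL2_zero]
  norm_op_le x := LinearIsometry.norm_toContinuousLinearMap_le _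
  continuous_op φ := by
    let g : C(G, C(G, G)) := (ContinuousMap.mk (fun a : G × G => a.1 + a.2) (by fun_prop)).curry
    exact (continuous_const (y := φ)).compMeasurePreservingLp g.continuous
      (fun x => measurePreserving_add_left Measure.addHaar x) ENNReal.ofNat_ne_top

end RegularRepresentation

/-! ### Injectivity of the Fourier transform on Radon probability measures. -/

section Uniqueness

theorem integral_eq_of_forall_exists_near {X : Type*} [TopologicalSpace X] [T2Space X]
    [MeasurableSpace X] [BorelSpace X] (μ ν : Measure X) [IsProbabilityMeasure μ]
    [IsProbabilityMeasure ν] [μ.Regular] [ν.Regular] {g : X → ℂ} (hg : Continuous g) {C : ℝ}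
    (hC : ∀ x, ‖g x‖ ≤ C)
    (h : ∀ ε > 0, ∃ g' : X → ℂ, Continuous g' ∧ (∀ x, ‖g' x - g x‖ ≤ ε) ∧
      ∫ x, g' x ∂μ = ∫ x, g' x ∂ν) :
    ∫ x, g x ∂μ = ∫ x, g x ∂ν := by
  rw [← sub_eq_zero, ← norm_le_zero_iff]
  refine le_of_forall_pos_le_add fun ε hε => ?_
  obtain ⟨g', hg', hgg', heq⟩ := h (ε / 2) (half_pos hε)
  have hC' : ∀ x, ‖g' x‖ ≤ C + ε / 2 := fun x => by
    calc ‖g' x‖ = ‖g x + (g' x - g x)‖ := by rw [add_sub_cancel]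
      _ ≤ C + ε / 2 := (norm_add_le _ _).trans (add_le_add (hC x) (hgg' x))
  have hnear : ∀ m : Measure X, IsProbabilityMeasure m → m.Regular →
      ‖∫ x, g' x ∂m - ∫ x, g x ∂m‖ ≤ ε / 2 := by
    intro m _ _
    rw [← integral_sub (hg'.integrable_of_regular hC' m) (hg.integrable_of_regular hC m)]
    simpa using norm_integral_le_of_norm_le_const (μ := m) (.of_forall hgg')
  have hμ := hnear μ inferInstance inferInstance
  have hν := hnear ν inferInstance inferInstance
  calc ‖∫ x, g x ∂μ - ∫ x, g x ∂ν‖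
      = ‖(∫ x, g' x ∂ν - ∫ x, g x ∂ν) - (∫ x, g' x ∂μ - ∫ x, g x ∂μ)‖ := by
        rw [heq]; congr 1; ring
    _ ≤ ε / 2 + ε / 2 := (norm_sub_le _ _).trans (add_le_add hν hμ)
    _ = 0 + ε := by ring

variable {G : Type*} [AddCommGroup G] [TopologicalSpace G] [IsTopologicalAddGroup G]
  [LocallyCompactSpace G] [T2Space G] [MeasurableSpace G] [BorelSpace G]
  (μ ν : Measure G) [IsProbabilityMeasure μ] [IsProbabilityMeasure ν] [μ.Regular] [ν.Regular]

/-- Matrix coefficients of unitary representations are determined in the mean by the Fourier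
transform of a measure. -/
theorem UnitaryRep.integral_inner_eq_of_fourierTransform_eq {H : Type*} [NormedAddCommGroup H]
    [InnerProductSpace ℂ H] [CompleteSpace H] (ρ : UnitaryRep G H)
    (h : ∀ γ : DualGroup G, fourierTransform μ γ = fourierTransform ν γ) (ψ φ : H) :
    ∫ x, inner ℂ ψ (ρ.op x φ) ∂μ = ∫ x, inner ℂ ψ (ρ.op x φ) ∂ν := by
  refine integral_eq_of_forall_exists_near μ ν (C := ‖ψ‖ * ‖φ‖)
    (continuous_const.inner (ρ.continuous_op φ)) (fun x => ?_) fun ε hε => ?_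
  · exact (norm_inner_le_norm _ _).trans
      (mul_le_mul_of_nonneg_left (ρ.norm_op_apply_le x φ) (norm_nonneg _))
  -- The added 1 covers ψ = 0.
  have hδ : 0 < ε / (‖ψ‖ + 1) := by positivity
  have hV : {y | ‖ρ.op y φ - φ‖ ≤ ε / (‖ψ‖ + 1)} ∈ nhds (0 : G) := by
    have hc : Continuous fun y => ‖ρ.op y φ - φ‖ := ((ρ.continuous_op φ).sub continuous_const).norm
    refine hc.continuousAt.preimage_mem_nhds (Iic_mem_nhds ?_)
    simpa [ρ.op_zero] using hδ
  obtain ⟨f, hfc, hfs, hf0, hfV, hf1⟩ := exists_bump_of_mem_nhds_zero hV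
  have hnear : ‖ρ.average hfc hfs φ - φ‖ ≤ ε / (‖ψ‖ + 1) :=
    norm_integral_smul_sub_le hfc hfs hf0 Measure.addHaar hf1 hfV (ρ.continuous_op φ)
      fun y hy => hy
  set T := ρ.average hfc hfs
  have hTc : Continuous fun x => ρ.op x * T := ρ.continuous_op_mul_average hfc hfs
  have hTle : ∀ x, ‖ρ.op x * T‖ ≤ ‖T‖ := fun x => (norm_mul_le _ _).trans
    (mul_le_of_le_one_left (norm_nonneg _) (ρ.norm_op_le x))
  refine ⟨fun x => inner ℂ ψ (ρ.op x (T φ)), continuous_const.inner (ρ.continuous_op _),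
    fun x => ?_, ?_⟩
  · rw [← inner_sub_right, ← map_sub]
    refine (norm_inner_le_norm _ _).trans ?_
    calc ‖ψ‖ * ‖ρ.op x (T φ - φ)‖ ≤ (‖ψ‖ + 1) * (ε / (‖ψ‖ + 1)) :=
          mul_le_mul (by linarith) ((ρ.norm_op_apply_le x _).trans hnear) (norm_nonneg _)
            (by positivity)
      _ = ε := by field_simp
  · let L : (H →L[ℂ] H) →L[ℂ] ℂ := (innerSL ℂ ψ).comp (ContinuousLinearMap.apply ℂ H φ)
    have := congrArg L (ρ.integral_mul_eq_of_fourierTransform_eq T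
      (ρ.average_mem_starBicommutant hfc hfs) hTc μ ν h)
    rw [← L.integral_comp_comm (hTc.integrable_of_regular hTle μ),
      ← L.integral_comp_comm (hTc.integrable_of_regular hTle ν)] at this
    exact this

/-- A Radon probability measure on a locally compact abelian group is determined by its Fourier
transform. -/
theorem eq_of_fourierTransform_eq
    (h : ∀ γ : DualGroup G, fourierTransform μ γ = fourierTransform ν γ) : μ = ν := by
  refine Measure.ext_of_integral_eq_on_compactlySupported fun k => ?_
  suffices h : ∫ x, (k x : ℂ) ∂μ = ∫ x, (k x : ℂ) ∂ν by
    rw [integral_complex_ofReal, integral_complex_ofReal] at h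
    exact_mod_cast h
  have hkc : Continuous fun x => (k x : ℂ) := Complex.continuous_ofReal.comp k.continuous
  have hks : HasCompactSupport fun x => (k x : ℂ) :=
    k.hasCompactSupport.comp_left (g := Complex.ofReal) Complex.ofReal_zero
  obtain ⟨C, hC⟩ := hks.exists_bound_of_continuous hkc
  refine integral_eq_of_forall_exists_near μ ν hkc hC fun ε hε => ?_
  let := IsTopologicalAddGroup.rightUniformSpace G
  have := isUniformAddGroup_of_addCommGroup (G := G)
  have huc : UniformContinuous fun x => (k x : ℂ) := hks.uniformContinuous_of_continuous hkc
  -- Uniform continuity gives one neighbourhood for all x, so smoothing by a bump supported there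
  -- moves k by at most ε in the sup norm.
  have hV : {y : G | ∀ x, ‖(k (x + y) : ℂ) - k x‖ ≤ ε} ∈ nhds (0 : G) := by
    have h1 := huc (Metric.dist_mem_uniformity hε)
    rw [Filter.mem_map, uniformity_eq_comap_nhds_zero, Filter.mem_comap] at h1
    obtain ⟨t, ht, hsub⟩ := h1
    refine Filter.mem_of_superset ht fun y hy x => ?_
    have h2 : (x, x + y) ∈ (fun p : G × G => p.2 - p.1) ⁻¹' t := by simpa using hy
    have h3 : dist (k x : ℂ) (k (x + y) : ℂ) < ε := hsub h2
    rw [dist_comm, dist_eq_norm] at h3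
    exact h3.le
  obtain ⟨f, hfc, hfs, hf0, hfV, hf1⟩ := exists_bump_of_mem_nhds_zero hV
  have hφ : MemLp (fun x => (k x : ℂ)) 2 (Measure.addHaar : Measure G) :=
    hkc.memLp_of_hasCompactSupport hks
  have hψ : MemLp (fun x => (f x : ℂ)) 2 (Measure.addHaar : Measure G) :=
    (Complex.continuous_ofReal.comp hfc).memLp_of_hasCompactSupport
      (hfs.comp_left (g := Complex.ofReal) Complex.ofReal_zero)
  refine ⟨fun x => inner ℂ (hψ.toLp _) ((regularRep G).op x (hφ.toLp _)),
    continuous_const.inner ((regularRep G).continuous_op _), fun x => ?_,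
    UnitaryRep.integral_inner_eq_of_fourierTransform_eq μ ν _ h _ _⟩
  -- The smoothed function is itself a matrix coefficient of the regular representation.
  have hin : inner ℂ (hψ.toLp _) ((regularRep G).op x (hφ.toLp _)) =
      ∫ y, f y • (k (x + y) : ℂ) ∂(Measure.addHaar : Measure G) := by
    change inner ℂ (hψ.toLp _) (translateL2 x (hφ.toLp _)) = _
    rw [translateL2_toLp, L2.inner_def]
    refine integral_congr_ae ?_
    filter_upwards [hψ.coeFn_toLp, (hφ.comp_measurePreserving
      (measurePreserving_add_left Measure.addHaar x)).coeFn_toLp] with y h1 h2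
    rw [h1]
    erw [h2]
    simp [mul_comm]
  beta_reduce
  rw [hin]
  exact norm_integral_smul_sub_le hfc hfs hf0 Measure.addHaar hf1 hfV
    (hkc.comp (continuous_const_add x)) fun y hy => hy x

end Uniqueness

/-! ### Elementary properties of characters. -/

section Character

variable {G : Type*} [AddCommGroup G] [TopologicalSpace G]

theorem norm_character (γ : DualGroup G) (x : Multiplicative G) : ‖(γ x : ℂ)‖ = 1 :=
  Circle.norm_coe _

theorem continuous_character (γ : DualGroup G) :
    Continuous fun x : G => (γ (Multiplicative.ofAdd x) : ℂ) :=
  continuous_subtype_val.comp ((map_continuous γ).comp continuous_ofAdd)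

theorem character_add (γ : DualGroup G) (x y : G) :
    (γ (Multiplicative.ofAdd (x + y)) : ℂ) =
      γ (Multiplicative.ofAdd x) * γ (Multiplicative.ofAdd y) := by
  rw [ofAdd_add, map_mul, Circle.coe_mul]

end Character

/-! ### Convolution of Radon probability measures. -/

section Convolution

variable {G : Type*} [AddCommGroup G] [TopologicalSpace G] [IsTopologicalAddGroup G]
  [LocallyCompactSpace G] [MeasurableSpace G]

open scoped Pointwise in
/-- The mass that the translates of a regular measure give to an open set is locally bounded below
on a compact subset. -/
theorem exists_isCompact_eventually_lt_measure_add_preimage (ν : Measure G) [ν.Regular]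
    {U : Set G} (hU : IsOpen U) {x₀ : G} {r : ENNReal} (hr : r < ν ((x₀ + ·) ⁻¹' U)) :
    ∃ K ⊆ U, IsCompact K ∧ ∀ᶠ x in nhds x₀, r < ν ((x + ·) ⁻¹' K) := by
  obtain ⟨C, hCU, hC, hrC⟩ :=
    (hU.preimage (continuous_const_add x₀)).exists_lt_isCompact hr
  have hC' : IsCompact ((x₀ + ·) '' C) := hC.image (continuous_const_add x₀)
  obtain ⟨V, hV, hVU⟩ := compact_open_separated_add_left hC' hU (Set.image_subset_iff.2 hCU)
  obtain ⟨W, hW, hWV, hWc⟩ := local_compact_nhds hV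
  refine ⟨W + (x₀ + ·) '' C, (Set.add_subset_add_right hWV).trans hVU, hWc.add hC', ?_⟩
  have hW' : ∀ᶠ x in nhds x₀, x - x₀ ∈ W := by
    have : Continuous fun x : G => x - x₀ := by fun_prop
    exact this.continuousAt.preimage_mem_nhds (by simpa using hW)
  filter_upwards [hW'] with x hx
  refine hrC.trans_le (measure_mono fun c hc => ?_)
  exact ⟨x - x₀, hx, x₀ + c, ⟨c, hc, rfl⟩, by simp only; abel⟩

theorem lowerSemicontinuous_measure_add_preimage (ν : Measure G) [ν.Regular] {U : Set G}
    (hU : IsOpen U) : LowerSemicontinuous fun x => ν ((x + ·) ⁻¹' U) := by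
  intro x₀ r hr
  obtain ⟨K, hKU, -, h⟩ := exists_isCompact_eventually_lt_measure_add_preimage ν hU hr
  filter_upwards [h] with x hx
  exact hx.trans_le (measure_mono (Set.preimage_mono hKU))

variable [BorelSpace G]

/-- For probability measures it suffices to test the π-system of open sets, where lower
semicontinuity gives measurability. -/
theorem measurable_map_const_add (ν : Measure G) [IsProbabilityMeasure ν] [ν.Regular] :
    Measurable fun x => ν.map fun y => x + y := by
  have hp : ∀ x, IsProbabilityMeasure (ν.map fun y => x + y) := fun x =>
    Measure.isProbabilityMeasure_map (measurable_const_add x).aemeasurable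
  refine .measure_of_isPiSystem_of_isProbabilityMeasure (S := {s | IsOpen s})
    (BorelSpace.measurable_eq.trans rfl) isPiSystem_isOpen fun U hU => ?_
  simp_rw [fun x => Measure.map_apply (measurable_const_add x)
    (hU : IsOpen U).measurableSet (μ := ν)]
  exact (lowerSemicontinuous_measure_add_preimage ν hU).measurable

variable (μ ν : Measure G) [IsProbabilityMeasure ν] [ν.Regular]

theorem measConv_apply {s : Set G} (hs : MeasurableSet s) :
    measConv μ ν s = ∫⁻ x, ν ((x + ·) ⁻¹' s) ∂μ := by
  rw [measConv, Measure.bind_apply hs (measurable_map_const_add ν).aemeasurable]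
  simp_rw [fun x => Measure.map_apply (measurable_const_add x) hs (μ := ν)]

variable [IsProbabilityMeasure μ]

instance : IsProbabilityMeasure (measConv μ ν) :=
  ⟨by rw [measConv_apply μ ν .univ]; simp⟩

variable [T2Space G] [μ.Regular]

/-- Inner regularity of a convolution on open sets, in quantitative form. -/
theorem exists_isCompact_measConv_le {U : Set G} (hU : IsOpen U) {ε : NNReal} (hε : 0 < ε) :
    ∃ K ⊆ U, IsCompact K ∧ measConv μ ν U ≤ measConv μ ν K + 4 * ε := by
  -- Vitali–Carathéodory: an upper semicontinuous minorant of x ↦ ν(U - x) with almost the same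
  -- integral. Its semicontinuity allows a compactness argument over `C`.
  obtain ⟨φ, hφle, hφ, hφint⟩ := exists_upperSemicontinuous_le_lintegral_le (μ := μ)
    (fun x => (ν ((x + ·) ⁻¹' U)).toNNReal)
    (by simp [ENNReal.coe_toNNReal, ← measConv_apply μ ν hU.measurableSet]) (ε := ε)
    (by exact_mod_cast hε.ne')
  have hφle' : ∀ x, (φ x : ENNReal) ≤ ν ((x + ·) ⁻¹' U) := fun x => by
    have := ENNReal.coe_le_coe.2 (hφle x)
    rwa [ENNReal.coe_toNNReal (measure_ne_top _ _)] at this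
  simp only [ENNReal.coe_toNNReal (measure_ne_top ν _)] at hφint
  obtain ⟨C, hC, hμC⟩ := exists_isCompact_measure_compl_lt μ
    (ε := ε) (by exact_mod_cast hε.ne')
  obtain ⟨K, hKU, hK, hKφ⟩ : ∃ K ⊆ U, IsCompact K ∧
      ∀ x ∈ C, (φ x : ENNReal) ≤ ν ((x + ·) ⁻¹' K) + 2 * ε := by
    refine hC.induction_on (p := fun s => ∃ K ⊆ U, IsCompact K ∧
      ∀ x ∈ s, (φ x : ENNReal) ≤ ν ((x + ·) ⁻¹' K) + 2 * ε)
      ⟨∅, Set.empty_subset _, isCompact_empty, by simp⟩ ?_ ?_ ?_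
    · rintro s t hst ⟨K, h1, h2, h3⟩
      exact ⟨K, h1, h2, fun x hx => h3 x (hst hx)⟩
    · rintro s t ⟨K, h1, h2, h3⟩ ⟨K', h1', h2', h3'⟩
      refine ⟨K ∪ K', Set.union_subset h1 h1', h2.union h2', ?_⟩
      rintro x (hx | hx)
      · exact (h3 x hx).trans (by gcongr; exact Set.subset_union_left)
      · exact (h3' x hx).trans (by gcongr; exact Set.subset_union_right)
    · intro x₀ _
      have husc : ∀ᶠ x in nhds x₀, φ x < φ x₀ + ε := hφ x₀ _ (lt_add_of_pos_right _ hε)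
      -- Near x₀, φ stays below φ(x₀) + ε, while a suitable K keeps ν(K - x) above φ(x₀) - ε; hence
      -- the loss 2ε. If φ(x₀) = 0, the truncated difference is not strictly smaller than φ(x₀), but
      -- K = ∅ already works.
      rcases eq_or_ne (φ x₀) 0 with h0 | h0
      · refine ⟨_, mem_nhdsWithin_of_mem_nhds husc, ∅, Set.empty_subset _, isCompact_empty,
          fun x hx => ?_⟩
        have hx' : φ x < φ x₀ + ε := hx
        rw [h0, zero_add] at hx'
        simp only [Set.preimage_empty, measure_empty, zero_add]
        calc (φ x : ENNReal) ≤ 1 * ε := by rw [one_mul]; exact_mod_cast hx'.le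
          _ ≤ 2 * ε := by gcongr; norm_num
      · have hlt : ((φ x₀ - ε : NNReal) : ENNReal) < ν ((x₀ + ·) ⁻¹' U) :=
          (ENNReal.coe_lt_coe.2 (tsub_lt_self (pos_iff_ne_zero.2 h0) hε)).trans_le (hφle' x₀)
        obtain ⟨K, hKU, hK, hev⟩ :=
          exists_isCompact_eventually_lt_measure_add_preimage ν hU hlt
        refine ⟨_, mem_nhdsWithin_of_mem_nhds (husc.and hev), K, hKU, hK, fun x hx => ?_⟩
        have hx1 : φ x ≤ (φ x₀ - ε) + 2 * ε := by
          calc φ x ≤ φ x₀ + ε := hx.1.le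
            _ ≤ (φ x₀ - ε + ε) + ε := by gcongr; exact le_tsub_add
            _ = _ := by ring
        calc (φ x : ENNReal) ≤ ((φ x₀ - ε : NNReal) : ENNReal) + 2 * ε := by exact_mod_cast hx1
          _ ≤ _ := by gcongr; exact hx.2.le
  refine ⟨K, hKU, hK, ?_⟩
  rw [measConv_apply μ ν hU.measurableSet, measConv_apply μ ν hK.measurableSet]
  have hCm := hC.measurableSet
  -- The error 4ε is ε for replacing ν(U - x) by φ, 2ε for the choice of K on `C`, and ε for the
  -- mass outside `C`.
  calc ∫⁻ x, ν ((x + ·) ⁻¹' U) ∂μ ≤ ∫⁻ x, φ x ∂μ + ε := hφint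
    _ = ∫⁻ x in C, φ x ∂μ + ∫⁻ x in Cᶜ, φ x ∂μ + ε := by rw [lintegral_add_compl _ hCm]
    _ ≤ ∫⁻ x in C, (ν ((x + ·) ⁻¹' K) + 2 * ε) ∂μ + ∫⁻ x in Cᶜ, 1 ∂μ + ε := by
        gcongr ?_ + ?_ + _
        · exact setLIntegral_mono' hCm hKφ
        · exact lintegral_mono fun x => (hφle' x).trans prob_le_one
    _ ≤ ∫⁻ x, (ν ((x + ·) ⁻¹' K) + 2 * ε) ∂μ + ε + ε := by
        gcongr ?_ + ?_ + _
        · exact setLIntegral_le_lintegral _ _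
        · simpa using hμC.le
    _ = ∫⁻ x, ν ((x + ·) ⁻¹' K) ∂μ + 4 * ε := by
        rw [lintegral_add_right _ measurable_const, lintegral_const, measure_univ, mul_one]
        ring

instance : (measConv μ ν).Regular := by
  have hinner : (measConv μ ν).InnerRegularWRT IsCompact IsOpen := by
    intro U hU r hr
    obtain ⟨δ, hδ, hrδ⟩ := ENNReal.lt_iff_exists_add_pos_lt.1 hr
    obtain ⟨K, hKU, hK, h⟩ := exists_isCompact_measConv_le μ ν hU
      (ε := δ / 4) (by positivity)
    refine ⟨K, hKU, hK, ?_⟩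
    have h4 : (4 : ENNReal) * ((δ / 4 : NNReal) : ENNReal) = δ := by
      have : (4 : NNReal) * (δ / 4) = δ := by field_simp
      exact_mod_cast this
    rw [h4] at h
    exact lt_of_add_lt_add_right (hrδ.trans_le h)
  have : (measConv μ ν).WeaklyRegular := Measure.InnerRegularWRT.weaklyRegular_of_finite _
    (hinner.mono (fun _ h => h) fun _ h => h.isClosed)
  exact { innerRegular := hinner }

/-- Viewed as a composition of kernels, the convolution gives an iterated integral, so joint
measurability of addition is not needed. -/
theorem fourierTransform_measConv (γ : DualGroup G) :
    fourierTransform (measConv μ ν) γ = fourierTransform μ γ * fourierTransform ν γ := by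
  let η : ProbabilityTheory.Kernel G G := ⟨fun x => ν.map fun y => x + y,
    measurable_map_const_add ν⟩
  have hbind : measConv μ ν = (η.comp (ProbabilityTheory.Kernel.const Unit μ)) () := by
    rw [ProbabilityTheory.Kernel.comp_apply]
    rfl
  have hi : Integrable (fun x => (γ (Multiplicative.ofAdd x) : ℂ)) (measConv μ ν) :=
    (continuous_character γ).integrable_of_regular (fun x => (norm_character γ _).le) _
  simp only [fourierTransform]
  rw [hbind, ProbabilityTheory.Kernel.integral_comp (by rwa [← hbind]),
    ProbabilityTheory.Kernel.const_apply, ← integral_mul_const]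
  refine integral_congr_ae (.of_forall fun x => ?_)
  change ∫ y, (γ (Multiplicative.ofAdd y) : ℂ) ∂(ν.map fun y => x + y) = _
  rw [integral_map (measurable_const_add x).aemeasurable
    (continuous_character γ).aestronglyMeasurable]
  simp_rw [character_add]
  exact integral_const_mul _ _

end Convolution

/-! ### Fourier transforms and convolution powers. -/

section RadonProb

variable {G : Type*} [AddCommGroup G] [TopologicalSpace G] [MeasurableSpace G]

theorem fourierTransform_one {ν : Measure G} (hν : ν ∈ RadonProb G) :
    fourierTransform ν 1 = 1 := by
  have := hν.1
  simp [fourierTransform]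

variable [BorelSpace G] [T2Space G]

theorem dirac_mem_radonProb {X : Type*} [TopologicalSpace X] [MeasurableSpace X] [BorelSpace X]
    [T1Space X] (x : X) : Measure.dirac x ∈ RadonProb X := by
  refine ⟨inferInstance, @Measure.Regular.mk _ _ _ _ _ ⟨fun A hA r hr => ?_⟩ fun U hU r hr => ?_⟩
  · by_cases hx : x ∈ A
    · refine ⟨Set.univ, Set.subset_univ _, isOpen_univ, ?_⟩
      simpa [Measure.dirac_apply' x hA, hx] using hr
    · refine ⟨{x}ᶜ, fun y hy => ?_, isOpen_compl_singleton, ?_⟩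
      · rintro rfl
        exact hx hy
      · rw [Measure.dirac_apply' x isOpen_compl_singleton.measurableSet]
        simpa using (zero_le.trans_lt hr)
  · by_cases hx : x ∈ U
    · refine ⟨{x}, Set.singleton_subset_iff.2 hx, isCompact_singleton, ?_⟩
      rw [Measure.dirac_apply_of_mem hx] at hr
      rwa [Measure.dirac_apply_of_mem (Set.mem_singleton x)]
    · simp [Measure.dirac_apply' x (hU : IsOpen U).measurableSet, hx] at hr

theorem fourierTransform_dirac_zero (γ : DualGroup G) :
    fourierTransform (Measure.dirac (0 : G)) γ = 1 := by
  simp [fourierTransform]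

theorem continuous_fourierTransform {ν : Measure G} (hν : ν ∈ RadonProb G) :
    Continuous (fourierTransform ν : DualGroup G → ℂ) := by
  obtain ⟨_, _⟩ := hν
  refine continuous_iff_continuousAt.2 fun γ₀ => Metric.tendsto_nhds.2 fun ε hε => ?_
  -- The integrand is at most 2 off K, contributing at most 2 · ε/8; uniform closeness ε/4 on K
  -- contributes at most ε/4.
  obtain ⟨K, hK, hνK⟩ := exists_isCompact_measure_compl_lt ν
    (ε := ENNReal.ofReal (ε / 8)) (by simpa using hε)
  have hun : ∀ᶠ γ : DualGroup G in nhds γ₀, ∀ x ∈ K,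
      ‖(γ (Multiplicative.ofAdd x) : ℂ) - γ₀ (Multiplicative.ofAdd x)‖ < ε / 4 := by
    have h1 := (ContinuousMonoidHom.isInducing_toContinuousMap
      (Multiplicative G) Circle).continuous.tendsto γ₀
    have h2 := ContinuousMap.tendsto_iff_forall_isCompact_tendstoUniformlyOn.1 h1
      (Multiplicative.ofAdd '' K) (hK.image continuous_ofAdd)
    filter_upwards [Metric.tendstoUniformlyOn_iff.1 h2 (ε / 4) (by positivity)] with γ hγ x hx
    have h3 : dist (γ₀ (Multiplicative.ofAdd x) : ℂ) (γ (Multiplicative.ofAdd x)) < ε / 4 :=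
      hγ _ ⟨x, hx, rfl⟩
    rwa [dist_comm, dist_eq_norm] at h3
  filter_upwards [hun] with γ hγ
  have hint : ∀ γ : DualGroup G, Integrable (fun x => (γ (Multiplicative.ofAdd x) : ℂ)) ν :=
    fun γ => (continuous_character γ).integrable_of_regular (fun x => (norm_character γ _).le) ν
  have hsub := (hint γ).sub (hint γ₀)
  have hνK' : ν.real Kᶜ ≤ ε / 8 := ENNReal.toReal_le_of_le_ofReal (by positivity) hνK.le
  rw [dist_eq_norm, fourierTransform, fourierTransform, ← integral_sub (hint γ) (hint γ₀),
    ← integral_add_compl (f := fun x => (γ (Multiplicative.ofAdd x) : ℂ) -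
      γ₀ (Multiplicative.ofAdd x)) hK.measurableSet hsub]
  have hA : ‖∫ x in K, ((γ (Multiplicative.ofAdd x) : ℂ) - γ₀ (Multiplicative.ofAdd x)) ∂ν‖ ≤
      ε / 4 * ν.real K :=
    norm_setIntegral_le_of_norm_le_const (measure_lt_top _ _) fun x hx => (hγ x hx).le
  have hB : ‖∫ x in Kᶜ, ((γ (Multiplicative.ofAdd x) : ℂ) - γ₀ (Multiplicative.ofAdd x)) ∂ν‖ ≤
      2 * ν.real Kᶜ := by
    refine norm_setIntegral_le_of_norm_le_const (measure_lt_top _ _) fun x _ => ?_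
    refine (norm_sub_le _ _).trans_eq ?_
    rw [norm_character, norm_character]
    norm_num
  have h1 : ν.real K ≤ 1 := measureReal_le_one
  calc _ ≤ ε / 4 * ν.real K + 2 * ν.real Kᶜ := (norm_add_le _ _).trans (add_le_add hA hB)
    _ < ε := by nlinarith

variable [IsTopologicalAddGroup G] [LocallyCompactSpace G]

theorem convPower_mem_radonProb {ν : Measure G} (hν : ν ∈ RadonProb G) (n : ℕ) :
    convPower ν n ∈ RadonProb G := by
  induction n with
  | zero => exact dirac_mem_radonProb 0
  | succ n ih =>
    obtain ⟨_, _⟩ := hν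
    obtain ⟨_, _⟩ := ih
    exact ⟨inferInstanceAs (IsProbabilityMeasure (measConv (convPower ν n) ν)),
      inferInstanceAs (measConv (convPower ν n) ν).Regular⟩

theorem fourierTransform_convPower {ν : Measure G} (hν : ν ∈ RadonProb G) (n : ℕ)
    (γ : DualGroup G) : fourierTransform (convPower ν n) γ = fourierTransform ν γ ^ n := by
  induction n with
  | zero => exact fourierTransform_dirac_zero γ
  | succ n ih =>
    obtain ⟨_, _⟩ := convPower_mem_radonProb hν n
    obtain ⟨_, _⟩ := hν
    rw [pow_succ, ← ih]
    exact fourierTransform_measConv _ _ γ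

end RadonProb

/-! ### Continuous roots of an exponential. -/

section Roots

/-- The function f e^{-ψ/n} is continuous with values in the finite set of n-th roots of unity, so
connectedness makes it constant. -/
theorem eq_exp_of_pow_eq_exp {X : Type*} [TopologicalSpace X] [PreconnectedSpace X] {x₀ : X}
    {f ψ : X → ℂ} (hf : Continuous f) (hψ : Continuous ψ) (hf₀ : f x₀ = 1) (hψ₀ : ψ x₀ = 0)
    {n : ℕ} (hn : 0 < n) (h : ∀ x, f x ^ n = Complex.exp (ψ x)) (x : X) :
    f x = Complex.exp (ψ x / n) := by
  have hn' : (n : ℂ) ≠ 0 := Nat.cast_ne_zero.2 hn.ne'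
  let g : X → ℂ := fun x => f x * Complex.exp (-(ψ x / n))
  have hg : Continuous g := by fun_prop
  have hgn : ∀ x, g x ^ n = 1 := fun x => by
    rw [mul_pow, h, ← Complex.exp_nat_mul, ← Complex.exp_add]
    rw [show ψ x + n * -(ψ x / n) = 0 by field_simp; ring, Complex.exp_zero]
  have hfin : {z : ℂ | z ^ n = 1}.Finite := by
    refine (Polynomial.nthRootsFinset n (1 : ℂ)).finite_toSet.subset fun z hz => ?_
    exact (Polynomial.mem_nthRootsFinset hn 1).2 hz
  have hsub : (Set.range g).Subsingleton :=
    hfin.countable.isTotallyDisconnected _ (by rintro _ ⟨x, rfl⟩; exact hgn x)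
      (isPreconnected_range hg)
  have h1 : g x = 1 := by
    rw [hsub ⟨x, rfl⟩ ⟨x₀, rfl⟩]
    simp [g, hf₀, hψ₀]
  calc f x = g x * Complex.exp (ψ x / n) := by
        rw [mul_assoc, ← Complex.exp_add, neg_add_cancel, Complex.exp_zero, mul_one]
    _ = Complex.exp (ψ x / n) := by rw [h1, one_mul]

end Roots

/-! ### Convolution roots and the sets Λ and Λ^alg. -/

theorem theorem2p2 {G : Type*} [AddCommGroup G] [TopologicalSpace G] [IsTopologicalAddGroup G]
    [LocallyCompactSpace G] [T2Space G] [MeasurableSpace G] [BorelSpace G]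
    [PathConnectedSpace (DualGroup G)] [LocallyPathConnectedSpace (DualGroup G)]
    (μ : Measure G) (hμ : μ ∈ AdmissibleProb G) :
    (∀ n : ℕ, 0 < n →
      (∀ ν ∈ RadonProb G, μ = convPower ν n →
        ν ∈ AdmissibleProb G ∧
        (∀ ν' ∈ RadonProb G, μ = convPower ν' n → ν' = ν) ∧
        ∀ ψ : DualGroup G → ℂ, IsSecondCharacteristic μ ψ →
          ∀ γ, fourierTransform ν γ = Complex.exp (ψ γ / n)) ∧
      ((∃ ν ∈ RadonProb G, μ = convPower ν n) ↔ (1 / (n : ℝ)) ∈ Lam μ)) ∧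
    LamAlg μ = Lam μ ∩ Set.range ((↑) : ℚ → ℝ) := by
  obtain ⟨hμR, ψ, hψ⟩ := hμ
  have hroot : ∀ n : ℕ, 0 < n → ∀ ν ∈ RadonProb G, μ = convPower ν n →
      ∀ ψ : DualGroup G → ℂ, IsSecondCharacteristic μ ψ →
        ∀ γ, fourierTransform ν γ = Complex.exp (ψ γ / n) := fun n hn ν hν h ψ hψ =>
    eq_exp_of_pow_eq_exp (continuous_fourierTransform hν) hψ.1 (fourierTransform_one hν) hψ.2.1
      hn fun γ => by rw [← fourierTransform_convPower hν, ← h, hψ.2.2]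
  have huniq : ∀ ν ∈ RadonProb G, ∀ ν' ∈ RadonProb G,
      (∀ γ, fourierTransform ν γ = fourierTransform ν' γ) → ν = ν' := by
    rintro ν ⟨_, _⟩ ν' ⟨_, _⟩ h
    exact eq_of_fourierTransform_eq ν ν' h
  refine ⟨fun n hn => ⟨fun ν hν h => ⟨⟨hν, fun γ => ψ γ / n, hψ.1.div_const _, by simp [hψ.2.1],
    hroot n hn ν hν h ψ hψ⟩, fun ν' hν' h' => huniq ν' hν' ν hν fun γ => ?_, hroot n hn ν hν h⟩,
    ⟨?_, ?_⟩⟩, Set.ext fun q => ⟨?_, ?_⟩⟩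
  · rw [hroot n hn ν hν h ψ hψ, hroot n hn ν' hν' h' ψ hψ]
  · rintro ⟨ν, hν, h⟩
    refine ⟨by positivity, ψ, hψ, ν, hν, fun γ => ?_⟩
    rw [hroot n hn ν hν h ψ hψ]
    push_cast
    ring_nf
  · rintro ⟨-, ψ', hψ', ν, hν, h⟩
    refine ⟨ν, hν, huniq _ hμR _ (convPower_mem_radonProb hν n) fun γ => ?_⟩
    have hn' : (n : ℂ) ≠ 0 := Nat.cast_ne_zero.2 hn.ne'
    rw [fourierTransform_convPower hν, h, hψ'.2.2, ← Complex.exp_nat_mul]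
    push_cast
    field_simp
  · rintro ⟨m, n, hm, hn, -, rfl, f, ⟨ν, hν, hf⟩, h⟩
    refine ⟨⟨by positivity, ψ, hψ, ν, hν, fun γ => ?_⟩, (m : ℚ) / n, by push_cast; rfl⟩
    -- Here ν̂ⁿ = e^{mψ}, so the root lemma applies with mψ as exponent.
    have := eq_exp_of_pow_eq_exp (ψ := fun γ => m * ψ γ) (continuous_fourierTransform hν)
      (hψ.1.const_mul _) (fourierTransform_one hν) (by simp [hψ.2.1]) hn (fun γ => by
        rw [hf, ← h, hψ.2.2, Complex.exp_nat_mul]) γ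
    rw [this]
    push_cast
    ring_nf
  · rintro ⟨⟨hq, ψ', hψ', hchar⟩, r, rfl⟩
    have hr : 0 < r := by exact_mod_cast hq
    have hnum : (r.num.toNat : ℤ) = r.num := Int.toNat_of_nonneg (Rat.num_pos.2 hr).le
    have hnumR : (r.num.toNat : ℝ) = r.num := by exact_mod_cast congrArg (Int.cast (R := ℝ)) hnum
    have hco : r.num.toNat.Coprime r.den := by
      have := r.reduced
      rwa [← hnum, Int.natAbs_natCast] at this
    have hrR : (r : ℝ) = (r.num.toNat : ℝ) / r.den := by rw [hnumR, ← Rat.cast_def]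
    -- The required f is e^{rψ'} itself, a characteristic function by `hchar`.
    refine ⟨r.num.toNat, r.den, by have := Rat.num_pos.2 hr; omega, r.den_pos, hco, hrR, _, hchar,
      fun γ => ?_⟩
    rw [hψ'.2.2, ← Complex.exp_nat_mul, ← Complex.exp_nat_mul, hrR]
    push_cast
    field_simp
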